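/- Let $\zeta^{*}(s) = \pi^{-s/2}\,\Gamma(s/2)\,\zeta(s)$ denote the completed Riemann zeta function, continued meromorphically to $\mathbb{C}$. The function $$Z_{2,\mathbb{Q}}(s) \;=\; \frac{\zeta^{*}(2s)}{s-1} \;-\; \frac{\zeta^{*}(2-2s)}{s}$$ (Weng's rank-2 zeta function over $\mathbb{Q}$) is meromorphic on $\mathbb{C}$, and all of its zeros lie on the critical line $\operatorname{Re}(s) = \tfrac12$. -/

import Mathlib

/-- Weng's rank two zeta function
`Z_{2,ℚ}(s) = ζ*(2s) / (s - 1) - ζ*(2 - 2s) / s`, where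
`ζ*(s) = π^(-s/2) Γ(s/2) ζ(s)` is the completed Riemann zeta function
(`completedRiemannZeta`, `completedRiemannZeta_eq`, `riemannZeta_def_of_ne_zero`).
As a Lean function it takes arbitrary values at the singular points `s = 0, 1/2, 1` of the
formula; as a meromorphic function it is determined by its values elsewhere. -/
noncomputable def wengZetaTwo (s : ℂ) : ℂ :=
  completedRiemannZeta (2 * s) * (1 / (s - 1)) - completedRiemannZeta (2 - 2 * s) * (1 / s)

/-- `ρ` is a zero of the meromorphic function `f`: the order of vanishing of `f` at `ρ` is
positive. This does not depend on the value that the Lean function `f` takes at `ρ` itself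
(it depends only on `f` in a punctured neighbourhood of `ρ`), so a pole is never a zero, and
at a removable singularity the continuous extension is used. -/
def IsMeromorphicZero (f : ℂ → ℂ) (ρ : ℂ) : Prop :=
  MeromorphicAt f ρ ∧ 0 < meromorphicOrderAt f ρ

/-!
Put `ξ(w) = w (w - 1) ζ*(w)`, which is entire with `ξ(1 - w) = ξ(w)`. Putting the two terms of
`Z_{2,ℚ}` over a common denominator gives
`Z_{2,ℚ}(s) = (ξ(2s) - ξ(2s - 1)) / (2s (s - 1) (2s - 1))`
(`wengZetaTwo_mul_eq_xiFun_sub`), whose numerator is odd under `s ↦ 1 - s`. Hence it is enough that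
`|ξ(2s - 1)| < |ξ(2s)|` for `re s > 1/2`, that is, `|f(z)| < 1` for `re z > 0`, where
`f(z) = ξ(z) / ξ(z + 1)` (`norm_xiRatio_lt_one`).

The function `f` is holomorphic on `re z ≥ 0` because `ζ` does not vanish on `re w ≥ 1`, and
`|f| = 1` on the imaginary axis by the functional equation and conjugation symmetry. So `|f| ≤ 1` follows from
the Phragmén–Lindelöf principle once the growth of `f` is controlled, and no Hadamard product is
needed. For `σ = re z > 0`,
`f(z) = B(z/2, 1/2) · (z - 1) ζ(z) / ((z + 1) ζ(z + 1))`,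
where `B` is the Beta integral. The Beta integral is bounded by `2 + 2/σ`, the factor `1 / ζ(z + 1)`
by `ζ(σ + 1) ≤ 2 + 1/σ`, and the formula `ζ(s) = s/(s-1) - s ∫₁^∞ {x} x^(-s-1) dx` bounds
`(z - 1) ζ(z)` by `|z| (1 + |z - 1|/σ)` (`norm_xiRatio_le`). These bounds blow up like `σ⁻³` at the
imaginary axis; since `|f| = 1` there, the maximum principle on a half disc removes the
singularity (`norm_le_of_norm_mul_re_pow_three_le`) and leaves linear growth. The inequality is
strict by the maximum principle again, because `f(1) = 3/π`.
-/

/-! ### Bounds for the zeta function and its inverse -/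

open Complex MeasureTheory Set Filter Topology in
lemma norm_integral_fract_mul_cpow_le {s : ℂ} (hs : 0 < s.re) :
    ‖∫ x in Ioi (1 : ℝ), (x : ℂ) ^ (-s - 1) * ((Int.fract x : ℝ) : ℂ)‖ ≤ 1 / s.re := by
  have h1 : -s.re - 1 < -1 := by linarith
  have hint := integrableOn_Ioi_rpow_of_lt h1 zero_lt_one
  refine (norm_integral_le_of_norm_le hint ?_).trans ?_
  · filter_upwards [ae_restrict_mem measurableSet_Ioi] with x hx
    have hx0 : 0 < x := zero_lt_one.trans hx
    rw [norm_mul, norm_cpow_eq_rpow_re_of_pos hx0, norm_real,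
      Real.norm_of_nonneg (Int.fract_nonneg x)]
    simpa using mul_le_of_le_one_right (by positivity) (Int.fract_lt_one x).le
  · rw [integral_Ioi_rpow_of_lt h1 zero_lt_one]
    apply le_of_eq
    have : s.re ≠ 0 := hs.ne'
    simp [neg_div_neg_eq]

open Complex MeasureTheory Set Filter Topology in
lemma differentiableAt_integral_fract_mul_cpow {s : ℂ} (hs : 0 < s.re) :
    DifferentiableAt ℂ
      (fun s : ℂ ↦ ∫ x in Ioi (1 : ℝ), (x : ℂ) ^ (-s - 1) * ((Int.fract x : ℝ) : ℂ)) s := by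
  -- The integral is the Mellin transform at `-s` of the fractional part cut off at `1`.
  set g : ℝ → ℂ := (Ioi (1 : ℝ)).indicator fun x ↦ ((Int.fract x : ℝ) : ℂ)
  have hg : (fun s : ℂ ↦ ∫ x in Ioi (1 : ℝ), (x : ℂ) ^ (-s - 1) * ((Int.fract x : ℝ) : ℂ)) =
      fun s ↦ mellin g (-s) := by
    ext s
    have : ∀ x : ℝ, (x : ℂ) ^ (-s - 1) • g x =
        (Ioi (1 : ℝ)).indicator (fun x : ℝ ↦ (x : ℂ) ^ (-s - 1) * ((Int.fract x : ℝ) : ℂ)) x := by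
      intro x
      by_cases hx : x ∈ Ioi (1 : ℝ) <;> simp [g, hx]
    simp only [mellin, this]
    rw [setIntegral_indicator measurableSet_Ioi, inter_eq_right.mpr (Ioi_subset_Ioi zero_le_one)]
  have hgm : Measurable g :=
    (measurable_ofReal.comp measurable_fract).indicator measurableSet_Ioi
  have hgb : ∀ x, ‖g x‖ ≤ 1 := by
    intro x
    by_cases hx : x ∈ Ioi (1 : ℝ)
    · simpa [g, hx, abs_of_nonneg (Int.fract_nonneg x)] using (Int.fract_lt_one x).le
    · simp [g, hx]
  rw [hg]
  have hd : DifferentiableAt ℂ (mellin g) (-s) := by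
    refine mellin_differentiableAt_of_isBigO_rpow (a := 0) (b := (-s).re - 1) ?_ ?_ ?_ ?_ ?_
    · refine LocallyIntegrable.locallyIntegrableOn ?_ _
      exact (locallyIntegrable_const (1 : ℝ)).mono hgm.aestronglyMeasurable
        (Eventually.of_forall fun x ↦ by simpa using hgb x)
    · refine Asymptotics.IsBigO.of_bound 1 (Eventually.of_forall fun x ↦ ?_)
      simpa using hgb x
    · simpa using hs
    · refine Asymptotics.IsBigO.of_bound 1 ?_
      filter_upwards [mem_nhdsWithin_of_mem_nhds (Iio_mem_nhds zero_lt_one)] with x hx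
      have : x ∉ Ioi (1 : ℝ) := notMem_Ioi.mpr (mem_Iio.mp hx).le
      simp only [g, indicator_of_notMem this, norm_zero]
      positivity
    · linarith
  exact hd.comp s (differentiableAt_neg_iff.mpr differentiableAt_id)

open Complex MeasureTheory Set Filter Topology in
lemma riemannZeta_eq_sub_integral_fract {s : ℂ} (hs : 1 < s.re) :
    riemannZeta s =
      s / (s - 1) - s * ∫ x in Ioi (1 : ℝ), (x : ℂ) ^ (-s - 1) * ((Int.fract x : ℝ) : ℂ) := by
  have hs0 : 0 < s.re := by linarith
  have hO : (fun n : ℕ ↦ ∑ k ∈ Finset.Icc 1 n, (1 : ℝ)) =O[atTop] fun n ↦ (n : ℝ) ^ (1 : ℝ) := by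
    simpa using Asymptotics.isBigO_refl _ _
  have h := LSeries_eq_mul_integral_of_nonneg (fun _ ↦ 1) zero_le_one hs hO fun _ ↦ zero_le_one
  have hL : LSeries (fun _ ↦ ((1 : ℝ) : ℂ)) s = riemannZeta s := by
    rw [← LSeries_one_eq_riemannZeta hs]; simp only [ofReal_one]; rfl
  rw [hL] at h
  rw [h, div_eq_mul_one_div, ← mul_sub]
  congr 1
  have h1 : (-s).re < -1 := by simpa using hs
  have hi1 : IntegrableOn (fun x : ℝ ↦ (x : ℂ) ^ (-s)) (Ioi 1) :=
    integrableOn_Ioi_cpow_of_lt h1 zero_lt_one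
  have hi2 : IntegrableOn (fun x : ℝ ↦ (x : ℂ) ^ (-s - 1) * ((Int.fract x : ℝ) : ℂ)) (Ioi 1) := by
    have h2 : (-s - 1).re < -1 := by simp; linarith
    refine (integrableOn_Ioi_cpow_of_lt h2 zero_lt_one).mul_bdd (c := 1)
      (measurable_ofReal.comp measurable_fract).aestronglyMeasurable
      (Eventually.of_forall fun x ↦ ?_)
    simpa [abs_of_nonneg (Int.fract_nonneg x)] using (Int.fract_lt_one x).le
  have hval : ∫ x in Ioi (1 : ℝ), (x : ℂ) ^ (-s) = 1 / (s - 1) := by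
    rw [integral_Ioi_cpow_of_lt h1 zero_lt_one, ofReal_one, one_cpow, ← neg_div_neg_eq]
    ring_nf
  rw [← hval, ← integral_sub hi1 hi2]
  refine setIntegral_congr_fun measurableSet_Ioi fun x hx ↦ ?_
  have hx0 : 0 < x := zero_lt_one.trans hx
  have hfl : ((⌊x⌋₊ : ℕ) : ℂ) = (x : ℂ) - ((Int.fract x : ℝ) : ℂ) := by
    have : ((⌊x⌋₊ : ℕ) : ℝ) = x - Int.fract x := by
      rw [natCast_floor_eq_intCast_floor hx0.le, Int.self_sub_fract]
    rw [← ofReal_sub, ← this, ofReal_natCast]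
  have hp : (x : ℂ) ^ (-s) = (x : ℂ) ^ (-s - 1) * x := by
    rw [cpow_sub _ _ (ofReal_ne_zero.mpr hx0.ne'), cpow_one, div_mul_cancel₀]
    exact ofReal_ne_zero.mpr hx0.ne'
  simp only [ofReal_one, Finset.sum_const, Nat.card_Icc, Nat.add_sub_cancel, nsmul_eq_mul, mul_one]
  rw [hfl, hp, neg_add']
  ring

open Complex MeasureTheory Set Filter Topology in
/-- Continuation of the fractional part formula to `0 < re s`, with the pole at `1` removed. -/
lemma riemannZeta₁_eq_sub_integral_fract {s : ℂ} (hs : 0 < s.re) :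
    riemannZeta₁ s =
      s - s * (s - 1) * ∫ x in Ioi (1 : ℝ), (x : ℂ) ^ (-s - 1) * ((Int.fract x : ℝ) : ℂ) := by
  have hopen : IsOpen {s : ℂ | 0 < s.re} := isOpen_lt continuous_const continuous_re
  refine AnalyticOnNhd.eqOn_of_preconnected_of_eventuallyEq (U := {s : ℂ | 0 < s.re}) (z₀ := 2)
    (f := riemannZeta₁) (g := fun s : ℂ ↦
      s - s * (s - 1) * ∫ x in Ioi (1 : ℝ), (x : ℂ) ^ (-s - 1) * ((Int.fract x : ℝ) : ℂ))
    (differentiable_riemannZeta₁.differentiableOn.analyticOnNhd hopen)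
    (DifferentiableOn.analyticOnNhd (fun z hz ↦ ?_) hopen)
    (convex_halfSpace_re_gt 0).isPreconnected (by simp) ?_ hs
  · have := differentiableAt_integral_fract_mul_cpow hz
    exact (by fun_prop : DifferentiableAt ℂ _ z).differentiableWithinAt
  · filter_upwards [(isOpen_lt continuous_const continuous_re).mem_nhds
      (show (1 : ℝ) < (2 : ℂ).re by simp)] with z hz
    have hz1 : z - 1 ≠ 0 := fun h ↦ by
      rw [sub_eq_zero.mp h] at hz; simp at hz
    have h := riemannZeta_eq_inv_sub_mul (sub_ne_zero.mp hz1)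
    rw [riemannZeta_eq_sub_integral_fract hz] at h
    field_simp at h
    linear_combination -h

lemma norm_riemannZeta₁_le {s : ℂ} (hs : 0 < s.re) :
    ‖riemannZeta₁ s‖ ≤ ‖s‖ * (1 + ‖s - 1‖ / s.re) := by
  rw [riemannZeta₁_eq_sub_integral_fract hs]
  refine (norm_sub_le _ _).trans ?_
  rw [norm_mul, norm_mul, mul_add, mul_one, mul_assoc, div_eq_mul_one_div ‖s - 1‖]
  gcongr
  exact norm_integral_fract_mul_cpow_le hs

/-- Since `1 / ζ` is the Dirichlet series of the Möbius function, it is dominated by `ζ (re s)`. -/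
lemma norm_inv_riemannZeta_le {s : ℂ} (hs : 1 < s.re) :
    ‖(riemannZeta s)⁻¹‖ ≤ 2 + 1 / (s.re - 1) := by
  have hr : 1 < ((s.re : ℝ) : ℂ).re := by simpa using hs
  have hinv : (riemannZeta s)⁻¹ = LSeries (fun n ↦ (ArithmeticFunction.moebius n : ℂ)) s := by
    have := LSeries_one_mul_Lseries_moebius hs
    rw [LSeries_one_eq_riemannZeta hs] at this
    exact inv_eq_of_mul_eq_one_right this
  have hsum := LSeriesHasSum_one hr
  have h1 : ‖LSeries (fun n ↦ (ArithmeticFunction.moebius n : ℂ)) s‖ ≤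
      ‖riemannZeta (s.re : ℂ)‖ := by
    have hterm : ∀ n, LSeries.term 1 (s.re : ℂ) n = (‖LSeries.term 1 s n‖ : ℂ) := by
      intro n
      rcases eq_or_ne n 0 with rfl | hn
      · simp
      · rw [LSeries.norm_term_eq]
        simp [hn, Complex.ofReal_cpow]
    have h2 : HasSum (fun n ↦ ‖LSeries.term 1 s n‖) (riemannZeta (s.re : ℂ)).re := by
      have := Complex.hasSum_re hsum
      simpa [hterm] using this
    refine (tsum_of_norm_bounded h2 fun n ↦ ?_).trans (Complex.re_le_norm _)
    refine LSeries.norm_term_le s ?_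
    simpa [← Int.cast_abs] using mod_cast ArithmeticFunction.abs_moebius_le_one (n := n)
  rw [hinv]
  refine h1.trans ?_
  have hne : (s.re : ℂ) ≠ 1 := by
    intro h; rw [h] at hr; simp at hr
  have hs1 : 0 < s.re - 1 := by linarith
  rw [riemannZeta_eq_inv_sub_mul hne, norm_mul, norm_inv]
  have h3 := norm_riemannZeta₁_le (s := (s.re : ℂ)) (by simp; linarith)
  have h4 : ‖(s.re : ℂ) - 1‖ = s.re - 1 := by
    rw [← Complex.ofReal_one, ← Complex.ofReal_sub, Complex.norm_real, Real.norm_of_nonneg hs1.le]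
  rw [h4, Complex.norm_real, Real.norm_of_nonneg (by linarith), Complex.ofReal_re] at h3
  rw [h4]
  calc (s.re - 1)⁻¹ * ‖riemannZeta₁ (s.re : ℂ)‖
      ≤ (s.re - 1)⁻¹ * (s.re * (1 + (s.re - 1) / s.re)) := by gcongr
    _ = 2 + 1 / (s.re - 1) := by
      have : s.re ≠ 0 := by linarith
      field_simp
      ring

/-! ### The entire function `ξ` -/

/-- Twice the classical Riemann `ξ`-function, `w (w - 1) ζ*(w)`. It is written through the entire
part of `ζ*`, which gives the right values at the removable singularities `w = 0, 1`. -/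
noncomputable def xiFun (w : ℂ) : ℂ := w * (w - 1) * completedRiemannZeta₀ w + 1

lemma differentiable_xiFun : Differentiable ℂ xiFun := by
  have := differentiable_completedZeta₀
  unfold xiFun
  fun_prop

lemma xiFun_one_sub (w : ℂ) : xiFun (1 - w) = xiFun w := by
  rw [xiFun, xiFun, completedRiemannZeta₀_one_sub]
  ring

lemma xiFun_eq_mul_completedRiemannZeta {w : ℂ} (h0 : w ≠ 0) (h1 : w ≠ 1) :
    xiFun w = w * (w - 1) * completedRiemannZeta w := by
  have h1' : 1 - w ≠ 0 := sub_ne_zero.mpr h1.symm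
  rw [xiFun, completedRiemannZeta_eq]
  field_simp
  ring

lemma xiFun_one : xiFun 1 = 1 := by simp [xiFun]

lemma xiFun_eq_mul_riemannZeta₁ {w : ℂ} (hw : 0 < w.re) :
    xiFun w = w * w.Gammaℝ * riemannZeta₁ w := by
  rcases eq_or_ne w 1 with rfl | h1
  · simp [xiFun_one, Complex.Gammaℝ_one]
  have h0 : w ≠ 0 := by rintro rfl; simp at hw
  have hG := Complex.Gammaℝ_ne_zero_of_re_pos hw
  have hz := riemannZeta_eq_inv_sub_mul h1
  rw [riemannZeta_def_of_ne_zero h0] at hz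
  have h1' : w - 1 ≠ 0 := sub_ne_zero.mpr h1
  rw [xiFun_eq_mul_completedRiemannZeta h0 h1]
  field_simp at hz
  linear_combination w * hz

lemma riemannZeta₁_ne_zero_of_one_le_re {w : ℂ} (hw : 1 ≤ w.re) : riemannZeta₁ w ≠ 0 := by
  rcases eq_or_ne w 1 with rfl | h1
  · simp
  · intro h
    have := riemannZeta_eq_inv_sub_mul h1
    rw [h, mul_zero] at this
    exact riemannZeta_ne_zero_of_one_le_re hw this

lemma xiFun_ne_zero_of_one_le_re {w : ℂ} (hw : 1 ≤ w.re) : xiFun w ≠ 0 := by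
  have h0 : 0 < w.re := by linarith
  rw [xiFun_eq_mul_riemannZeta₁ h0]
  have : w ≠ 0 := by rintro rfl; simp at h0
  exact mul_ne_zero (mul_ne_zero this (Complex.Gammaℝ_ne_zero_of_re_pos h0))
    (riemannZeta₁_ne_zero_of_one_le_re hw)

open ComplexConjugate in
lemma xiFun_conj_of_re_pos {w : ℂ} (hw : 0 < w.re) : xiFun (conj w) = conj (xiFun w) := by
  rcases eq_or_ne w 1 with rfl | h1
  · simp [xiFun_one]
  have h1' : conj w ≠ 1 := fun h ↦ h1 (by simpa using congrArg conj h)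
  have hw' : 0 < (conj w).re := by simpa using hw
  have hz : riemannZeta₁ (conj w) = conj (riemannZeta₁ w) := by
    have e1 := riemannZeta_eq_inv_sub_mul h1
    have e2 := riemannZeta_eq_inv_sub_mul h1'
    rw [riemannZeta_conj, e1] at e2
    have n1 : w - 1 ≠ 0 := sub_ne_zero.mpr h1
    have n2 : conj w - 1 ≠ 0 := sub_ne_zero.mpr h1'
    simp only [map_mul, map_inv₀, map_sub, map_one] at e2
    exact (mul_left_cancel₀ (inv_ne_zero n2) e2).symm
  have hG : (conj w).Gammaℝ = conj w.Gammaℝ := by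
    have harg : (Real.pi : ℂ).arg ≠ Real.pi := by
      rw [Complex.arg_ofReal_of_nonneg Real.pi_pos.le]
      exact Real.pi_pos.ne
    rw [Complex.Gammaℝ_def, Complex.Gammaℝ_def, map_mul, ← Complex.Gamma_conj,
      show -conj w / 2 = conj (-w / 2) by simp [map_ofNat],
      Complex.cpow_conj _ _ harg, Complex.conj_ofReal]
    simp [map_ofNat]
  rw [xiFun_eq_mul_riemannZeta₁ hw, xiFun_eq_mul_riemannZeta₁ hw', hz, hG, map_mul, map_mul]

lemma xiFun_two : xiFun 2 = (Real.pi / 3 : ℝ) := by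
  rw [xiFun_eq_mul_completedRiemannZeta (by norm_num) (by norm_num)]
  have h := riemannZeta_def_of_ne_zero (s := 2) (by norm_num)
  have hG : Complex.Gammaℝ 2 = (Real.pi : ℂ)⁻¹ := by
    rw [Complex.Gammaℝ_def]; norm_num [Complex.cpow_neg_one]
  have hpi : (Real.pi : ℂ) ≠ 0 := by exact_mod_cast Real.pi_ne_zero
  rw [riemannZeta_two, hG] at h
  push_cast
  field_simp at h
  linear_combination -h / 3

/-! ### The quotient of consecutive archimedean factors -/

open Complex MeasureTheory Set in
lemma norm_betaIntegral_half_le {a : ℂ} (ha : 0 < a.re) :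
    ‖betaIntegral a (1 / 2)‖ ≤ 2 + 1 / a.re := by
  have hi1 : IntervalIntegrable (fun x : ℝ ↦ (1 - x) ^ (-1 / 2 : ℝ)) volume 0 1 := by
    have := (intervalIntegral.intervalIntegrable_rpow' (a := 0) (b := 1)
      (r := -1 / 2) (by norm_num)).comp_sub_left 1
    simpa using this.symm
  have hi2 : IntervalIntegrable (fun x : ℝ ↦ x ^ (a.re - 1)) volume 0 1 :=
    intervalIntegral.intervalIntegrable_rpow' (by linarith)
  refine (intervalIntegral.norm_integral_le_of_norm_le zero_le_one ?_ (hi1.add hi2)).trans ?_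
  · have hne : ∀ᵐ x : ℝ, x ≠ 1 := by simp [ae_iff]
    filter_upwards [hne] with x hx1 hx
    have hx0 : 0 < x := hx.1
    have hy0 : 0 < 1 - x := sub_pos.mpr (lt_of_le_of_ne hx.2 hx1)
    have hy : (1 - (x : ℂ)) = ((1 - x : ℝ) : ℂ) := by push_cast; rfl
    rw [norm_mul, hy, norm_cpow_eq_rpow_re_of_pos hx0, norm_cpow_eq_rpow_re_of_pos hy0]
    have hre : (1 / 2 - 1 : ℂ).re = -1 / 2 := by norm_num
    rw [hre, sub_re, one_re]
    have e1 : x ^ (a.re - 1) * x = x ^ a.re := by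
      rw [← Real.rpow_add_one hx0.ne']; ring_nf
    have e2 : (1 - x) ^ (-1 / 2 : ℝ) * (1 - x) = (1 - x) ^ (1 / 2 : ℝ) := by
      rw [← Real.rpow_add_one hy0.ne']; norm_num
    -- Weighting the integrand by `x + (1 - x) = 1` separates the two singularities.
    calc x ^ (a.re - 1) * (1 - x) ^ (-1 / 2 : ℝ)
        = x ^ a.re * (1 - x) ^ (-1 / 2 : ℝ) + x ^ (a.re - 1) * (1 - x) ^ (1 / 2 : ℝ) := by
          rw [← e1, ← e2]; ring
      _ ≤ 1 * (1 - x) ^ (-1 / 2 : ℝ) + x ^ (a.re - 1) * 1 := by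
          gcongr
          · exact Real.rpow_le_one hx0.le hx.2 ha.le
          · exact Real.rpow_le_one hy0.le (by linarith) (by norm_num)
      _ = _ := by ring
  · rw [intervalIntegral.integral_add hi1 hi2, integral_rpow (Or.inl (by linarith)),
      intervalIntegral.integral_comp_sub_left (fun x ↦ x ^ (-1 / 2 : ℝ)),
      integral_rpow (Or.inl (by norm_num))]
    norm_num [ha.ne']

/-- The quotient of archimedean factors is a Beta integral, by `Γ(1/2) = √π`. -/
lemma Gammaℝ_eq_Gammaℝ_add_one_mul_betaIntegral {z : ℂ} (hz : 0 < z.re) :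
    z.Gammaℝ = (z + 1).Gammaℝ * Complex.betaIntegral (z / 2) (1 / 2) := by
  have h := Complex.Gamma_mul_Gamma_eq_betaIntegral (s := z / 2) (t := 1 / 2)
    (by simpa using hz) (by norm_num)
  have hpi : (Real.pi : ℂ) ≠ 0 := by exact_mod_cast Real.pi_ne_zero
  rw [Complex.Gamma_one_half_eq, ← add_div] at h
  rw [Complex.Gammaℝ_def, Complex.Gammaℝ_def, mul_assoc, ← h, mul_comm (Complex.Gamma _),
    ← mul_assoc, ← Complex.cpow_add _ _ hpi]
  ring_nf

/-! ### The quotient `ξ(z) / ξ(z + 1)` -/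

/-- The quotient whose modulus decides the zeros of `ξ(z + 1) - ξ(z)`. -/
noncomputable def xiRatio (z : ℂ) : ℂ := xiFun z / xiFun (z + 1)

lemma differentiableAt_xiRatio {z : ℂ} (hz : 0 ≤ z.re) : DifferentiableAt ℂ xiRatio z := by
  have h := differentiable_xiFun
  have : xiFun (z + 1) ≠ 0 := xiFun_ne_zero_of_one_le_re (by simpa using hz)
  unfold xiRatio
  fun_prop (disch := assumption)

lemma norm_xiRatio_of_re_eq_zero {z : ℂ} (hz : z.re = 0) : ‖xiRatio z‖ = 1 := by
  have h1 : 1 - z = (starRingEnd ℂ) (z + 1) := by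
    apply Complex.ext <;> simp [hz]
  have h2 : 0 < (z + 1).re := by simp [hz]
  have h3 : xiFun (z + 1) ≠ 0 := xiFun_ne_zero_of_one_le_re (by simp [hz])
  rw [xiRatio, ← xiFun_one_sub z, h1, xiFun_conj_of_re_pos h2, norm_div, Complex.norm_conj,
    div_self (norm_ne_zero_iff.mpr h3)]

lemma norm_xiRatio_le {z : ℂ} (hz : 0 < z.re) :
    ‖xiRatio z‖ ≤ (2 + 2 / z.re) * (1 + ‖z - 1‖ / z.re) * (2 + 1 / z.re) := by
  have hz1 : 0 < (z + 1).re := by simp; linarith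
  have hz1' : 1 < (z + 1).re := by simpa using hz
  have h0 : z ≠ 0 := by rintro rfl; simp at hz
  have h1 : z + 1 ≠ 0 := fun h ↦ by rw [h] at hz1; simp at hz1
  have hG := Complex.Gammaℝ_ne_zero_of_re_pos hz1
  have hζ := riemannZeta_ne_zero_of_one_le_re hz1'.le
  have hr : riemannZeta₁ (z + 1) = z * riemannZeta (z + 1) := by
    rw [riemannZeta_eq_inv_sub_mul (by simpa using h0), add_sub_cancel_right,
      mul_inv_cancel_left₀ h0]
  have heq : xiRatio z = Complex.betaIntegral (z / 2) (1 / 2) *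
      (riemannZeta₁ z / (z + 1)) * (riemannZeta (z + 1))⁻¹ := by
    rw [xiRatio, xiFun_eq_mul_riemannZeta₁ hz, xiFun_eq_mul_riemannZeta₁ hz1, hr,
      Gammaℝ_eq_Gammaℝ_add_one_mul_betaIntegral hz]
    field_simp
  have b1 : ‖Complex.betaIntegral (z / 2) (1 / 2)‖ ≤ 2 + 2 / z.re := by
    have hre : (z / 2).re = z.re / 2 := by simp
    have := norm_betaIntegral_half_le (a := z / 2) (by rw [hre]; positivity)
    rwa [hre, one_div_div] at this
  have b2 : ‖riemannZeta₁ z / (z + 1)‖ ≤ 1 + ‖z - 1‖ / z.re := by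
    have hle : ‖z‖ ≤ ‖z + 1‖ := by
      rw [Complex.norm_def, Complex.norm_def]
      apply Real.sqrt_le_sqrt
      simp only [Complex.normSq_apply, Complex.add_re, Complex.add_im, Complex.one_re,
        Complex.one_im]
      nlinarith
    rw [norm_div, div_le_iff₀ (norm_pos_iff.mpr h1), mul_comm]
    exact (norm_riemannZeta₁_le hz).trans (by gcongr)
  have b3 : ‖(riemannZeta (z + 1))⁻¹‖ ≤ 2 + 1 / z.re := by
    simpa using norm_inv_riemannZeta_le hz1'
  rw [heq, norm_mul, norm_mul]
  gcongr

/-! ### The quotient has modulus less than one in the right half plane -/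

open Complex Set Metric in
/-- A bound by `M / (re w) ^ 3` inside a half plane, together with a bound by `1` on its boundary
line, improves to a bound without singularity. The maximum principle is applied on the half disc
of radius `1` around `c = i im z`, to `f` times the cube of `(w - c) ^ 2 + 1`: on the bounding arc
this factor has modulus `2 re w`, and at `z` it is at least `1`. -/
lemma norm_le_of_norm_mul_re_pow_three_le {f : ℂ → ℂ} {z : ℂ} {M : ℝ}
    (hf : DiffContOnCl ℂ f {w | 0 < w.re}) (hz : 0 < z.re) (hz1 : z.re < 1) (hM : 1 ≤ M)
    (h0 : ∀ w : ℂ, w.re = 0 → ‖f w‖ ≤ 1)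
    (h1 : ∀ w : ℂ, 0 < w.re → ‖w - z.im * I‖ = 1 → ‖f w‖ * w.re ^ 3 ≤ M) :
    ‖f z‖ ≤ 8 * M := by
  set c : ℂ := z.im * I with hc
  have hcre : c.re = 0 := by simp [hc]
  set g : ℂ → ℂ := fun w ↦ ((w - c) ^ 2 + 1) ^ 3 • f w with hg
  have hpoly : Differentiable ℂ fun w : ℂ ↦ ((w - c) ^ 2 + 1) ^ 3 := by fun_prop
  have hd : DiffContOnCl ℂ g (ball c 1 ∩ {w | 0 < w.re}) :=
    hpoly.diffContOnCl.smul (hf.mono inter_subset_right)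
  have hbd : Bornology.IsBounded (ball c 1 ∩ {w : ℂ | 0 < w.re}) :=
    isBounded_ball.subset inter_subset_left
  have hline : ∀ w : ℂ, w.re = 0 → ‖w - c‖ ≤ 1 → ‖g w‖ ≤ 8 * M := by
    intro w hw hwc
    have e : ‖(w - c) ^ 2 + 1‖ ≤ 2 := by
      refine (norm_add_le _ _).trans ?_
      rw [norm_pow, norm_one]
      have := pow_le_one₀ (n := 2) (norm_nonneg (w - c)) hwc
      linarith
    rw [hg, norm_smul, norm_pow]
    calc ‖(w - c) ^ 2 + 1‖ ^ 3 * ‖f w‖ ≤ 2 ^ 3 * 1 := by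
          gcongr
          exact h0 w hw
      _ ≤ 8 * M := by linarith
  have hfr : ∀ w ∈ frontier (ball c 1 ∩ {w : ℂ | 0 < w.re}), ‖g w‖ ≤ 8 * M := by
    intro w hw
    have hfron : frontier {w : ℂ | 0 < w.re} = {w | w.re = 0} := by simp
    have hclos : closure {w : ℂ | 0 < w.re} = {w | 0 ≤ w.re} := by simp
    have h := frontier_inter_subset _ _ hw
    rw [hfron, hclos, frontier_ball c one_ne_zero, closure_ball c one_ne_zero] at h
    rcases h with ⟨ha, hb⟩ | ⟨ha, hb⟩
    · have ha' : ‖w - c‖ = 1 := by simpa [dist_eq_norm] using ha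
      rcases (show 0 ≤ w.re from hb).eq_or_lt with hb | hb
      · exact hline w hb.symm ha'.le
      -- On the unit circle `u ^ 2 + 1 = u (u + conj u) = 2 u (re u)`.
      have e : ‖(w - c) ^ 2 + 1‖ = 2 * w.re := by
        have hu : (w - c) ^ 2 + 1 = (w - c) * ((2 * w.re : ℝ) : ℂ) := by
          have h2 : (w - c) * (starRingEnd ℂ) (w - c) = 1 := by
            rw [mul_conj, normSq_eq_norm_sq, ha']; simp
          have h3 := add_conj (w - c)
          rw [sub_re, hcre, sub_zero] at h3
          rw [← h3, mul_add, h2]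
          ring
        rw [hu, norm_mul, ha', one_mul, norm_real, Real.norm_of_nonneg (by linarith)]
      rw [hg, norm_smul, norm_pow, e]
      nlinarith [h1 w hb ha']
    · exact hline w hb (by simpa [dist_eq_norm] using ha)
  have hzc : z - c = (z.re : ℂ) := by
    apply Complex.ext <;> simp [hc]
  have hmem : z ∈ ball c 1 ∩ {w : ℂ | 0 < w.re} := by
    refine ⟨?_, hz⟩
    rw [mem_ball, dist_eq_norm, hzc, norm_real, Real.norm_of_nonneg hz.le]
    exact hz1
  have hgz := norm_le_of_forall_mem_frontier_norm_le hbd hd hfr (subset_closure hmem)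
  refine le_trans ?_ hgz
  have e : ‖(z - c) ^ 2 + 1‖ = z.re ^ 2 + 1 := by
    rw [hzc, ← ofReal_pow, ← ofReal_one, ← ofReal_add, norm_real,
      Real.norm_of_nonneg (by positivity)]
  rw [hg, norm_smul, norm_pow, e]
  exact le_mul_of_one_le_left (norm_nonneg _) (one_le_pow₀ (by nlinarith))

lemma diffContOnCl_xiRatio : DiffContOnCl ℂ xiRatio {z | 0 < z.re} := by
  refine DifferentiableOn.diffContOnCl fun z hz ↦ ?_
  rw [Complex.closure_setOfPred_lt_re] at hz
  exact (differentiableAt_xiRatio hz).differentiableWithinAt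

lemma norm_xiRatio_le_of_one_le_re {z : ℂ} (hz : 1 ≤ z.re) :
    ‖xiRatio z‖ ≤ 12 * (1 + ‖z - 1‖ / z.re) := by
  have h0 : 0 < z.re := by linarith
  refine (norm_xiRatio_le h0).trans ?_
  have h1 : 1 / z.re ≤ 1 := (div_le_one h0).mpr hz
  have h2 : 2 + 2 / z.re ≤ 4 := by
    rw [div_eq_mul_one_div]; linarith
  calc (2 + 2 / z.re) * (1 + ‖z - 1‖ / z.re) * (2 + 1 / z.re)
      ≤ 4 * (1 + ‖z - 1‖ / z.re) * 3 := by gcongr; linarith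
    _ = _ := by ring

/-- The three singular factors of `norm_xiRatio_le` cost only a third power of `re z`. -/
lemma norm_xiRatio_mul_re_pow_three_le {z : ℂ} (h0 : 0 < z.re) (h1 : z.re ≤ 1) :
    ‖xiRatio z‖ * z.re ^ 3 ≤ 12 * (2 + ‖z‖) := by
  have hz1 : ‖z - 1‖ ≤ ‖z‖ + 1 := by simpa using norm_sub_le z 1
  calc ‖xiRatio z‖ * z.re ^ 3
      ≤ (2 + 2 / z.re) * (1 + ‖z - 1‖ / z.re) * (2 + 1 / z.re) * z.re ^ 3 := by
        gcongr
        exact norm_xiRatio_le h0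
    _ = (2 * z.re + 2) * (z.re + ‖z - 1‖) * (2 * z.re + 1) := by field_simp
    _ ≤ (2 * 1 + 2) * (1 + (‖z‖ + 1)) * (2 * 1 + 1) := by gcongr
    _ = _ := by ring

lemma norm_xiRatio_le_linear {z : ℂ} (hz : 0 < z.re) : ‖xiRatio z‖ ≤ 96 * (‖z‖ + 3) := by
  rcases lt_or_ge z.re 1 with h1 | h1
  · have := norm_le_of_norm_mul_re_pow_three_le (M := 12 * (‖z‖ + 3)) diffContOnCl_xiRatio hz h1
      (by linarith [norm_nonneg z]) (fun w hw ↦ (norm_xiRatio_of_re_eq_zero hw).le) ?_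
    · linarith
    · intro w hw hwc
      have hw1 : w.re ≤ 1 := by
        have := Complex.re_le_norm (w - z.im * Complex.I)
        rw [hwc] at this
        simpa using this
      have hwn : ‖w‖ ≤ 1 + ‖z‖ := by
        have h2 := norm_add_le (w - z.im * Complex.I) (z.im * Complex.I)
        have h3 := Complex.abs_im_le_norm z
        rw [hwc, sub_add_cancel, norm_mul, Complex.norm_I, mul_one, Complex.norm_real,
          Real.norm_eq_abs] at h2
        linarith
      refine (norm_xiRatio_mul_re_pow_three_le hw hw1).trans ?_
      linarith
  · refine (norm_xiRatio_le_of_one_le_re h1).trans ?_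
    have hz1 : ‖z - 1‖ ≤ ‖z‖ + 1 := by simpa using norm_sub_le z 1
    have := div_le_self (norm_nonneg (z - 1)) h1
    linarith [norm_nonneg z]

open Filter Complex in
/-- Phragmén–Lindelöf in the right half plane: `xiRatio` has modulus `1` on the imaginary axis, is
bounded on the positive reals, and grows at most linearly. -/
lemma norm_xiRatio_le_one {z : ℂ} (hz : 0 ≤ z.re) : ‖xiRatio z‖ ≤ 1 := by
  refine PhragmenLindelof.right_half_plane_of_bounded_on_real diffContOnCl_xiRatio
    ⟨1, by norm_num, 1, ?_⟩ ?_ (fun x ↦ (norm_xiRatio_of_re_eq_zero (by simp)).le) hz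
  · refine Asymptotics.IsBigO.of_bound 288 ?_
    filter_upwards [mem_inf_of_right (mem_principal_self _)] with w hw
    refine (norm_xiRatio_le_linear hw).trans ?_
    rw [Real.rpow_one, one_mul, Real.norm_of_nonneg (Real.exp_pos _).le]
    linarith [Real.add_one_le_exp ‖w‖, norm_nonneg w]
  · refine isBoundedUnder_of_eventually_le (a := 24) ?_
    filter_upwards [eventually_ge_atTop 1] with x hx
    refine (norm_xiRatio_le_of_one_le_re (by simpa using hx)).trans ?_
    have h1 : ‖(x : ℂ) - 1‖ = x - 1 := by
      rw [← ofReal_one, ← ofReal_sub, norm_real, Real.norm_of_nonneg (by linarith)]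
    have h2 : (x - 1) / x ≤ 1 := (div_le_one (by linarith)).mpr (by linarith)
    rw [h1, ofReal_re]
    linarith

open Complex Set in
lemma norm_xiRatio_lt_one {z : ℂ} (hz : 0 < z.re) : ‖xiRatio z‖ < 1 := by
  refine lt_of_le_of_ne (norm_xiRatio_le_one hz.le) fun h ↦ ?_
  -- By the maximum principle `xiRatio` would have modulus `1` at the point `1`, but it is `3 / π`.
  have hopen : IsOpen {w : ℂ | 0 < w.re} := isOpen_lt continuous_const continuous_re
  have hmax : IsMaxOn (norm ∘ xiRatio) {w : ℂ | 0 < w.re} z := fun w hw ↦ by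
    simpa [h] using norm_xiRatio_le_one (le_of_lt hw)
  have h1 := norm_eqOn_of_isPreconnected_of_isMaxOn (convex_halfSpace_re_gt 0).isPreconnected
    hopen diffContOnCl_xiRatio.differentiableOn hz hmax (show (1 : ℂ) ∈ {w : ℂ | 0 < w.re} by simp)
  have h2 : xiRatio 1 = ((3 / Real.pi : ℝ) : ℂ) := by
    rw [xiRatio, xiFun_one, one_add_one_eq_two, xiFun_two, ← ofReal_one, ← ofReal_div, one_div_div]
  simp only [Function.comp_apply, Function.const_apply, h] at h1
  rw [h2, norm_real, Real.norm_of_nonneg (by positivity), div_eq_one_iff_eq Real.pi_ne_zero] at h1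
  exact Real.pi_gt_three.ne h1

/-! ### The zeros of the rank two zeta function -/

lemma xiFun_sub_ne_zero_of_half_lt_re {s : ℂ} (hs : 1 / 2 < s.re) :
    xiFun (2 * s) - xiFun (2 * s - 1) ≠ 0 := by
  intro h
  have hre : (2 * s - 1).re = 2 * s.re - 1 := by simp
  have hlt := norm_xiRatio_lt_one (z := 2 * s - 1) (by rw [hre]; linarith)
  have hne : xiFun (2 * s) ≠ 0 := xiFun_ne_zero_of_one_le_re (by simp; linarith)
  rw [xiRatio, sub_add_cancel, ← sub_eq_zero.mp h, div_self hne, norm_one] at hlt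
  exact lt_irrefl _ hlt

lemma re_eq_half_of_xiFun_sub_eq_zero {s : ℂ} (h : xiFun (2 * s) - xiFun (2 * s - 1) = 0) :
    s.re = 1 / 2 := by
  rcases lt_trichotomy s.re (1 / 2) with hs | hs | hs
  · -- The difference is odd under `s ↦ 1 - s`.
    refine absurd ?_ (xiFun_sub_ne_zero_of_half_lt_re (s := 1 - s) (by simp; linarith))
    rw [← xiFun_one_sub (2 * (1 - s)), ← xiFun_one_sub (2 * (1 - s) - 1)]
    ring_nf at h ⊢
    linear_combination -h
  · exact hs
  · exact absurd h (xiFun_sub_ne_zero_of_half_lt_re hs)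

lemma wengZetaTwo_mul_eq_xiFun_sub {s : ℂ} (h0 : s ≠ 0) (h1 : s ≠ 1) (h2 : 2 * s ≠ 1) :
    wengZetaTwo s * (2 * s * (s - 1) * (2 * s - 1)) = xiFun (2 * s) - xiFun (2 * s - 1) := by
  have h0' : 2 * s ≠ 0 := mul_ne_zero two_ne_zero h0
  have h1' : s - 1 ≠ 0 := sub_ne_zero.mpr h1
  have hL : completedRiemannZeta (2 - 2 * s) = completedRiemannZeta (2 * s - 1) := by
    rw [← completedRiemannZeta_one_sub]; ring_nf
  rw [wengZetaTwo, hL, xiFun_eq_mul_completedRiemannZeta h0' h2,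
    xiFun_eq_mul_completedRiemannZeta (sub_ne_zero.mpr h2)
      (fun h ↦ h1' (by linear_combination h / 2))]
  field_simp
  ring

lemma meromorphic_wengZetaTwo : Meromorphic wengZetaTwo := by
  intro s
  have h0 : ∀ g : ℂ → ℂ, Differentiable ℂ g →
      MeromorphicAt (fun s ↦ completedRiemannZeta₀ (g s)) s :=
    fun g hg ↦ ((differentiable_completedZeta₀.comp hg).analyticAt s).meromorphicAt
  have h1 := h0 (fun s ↦ 2 * s) (by fun_prop)
  have h2 := h0 (fun s ↦ 2 - 2 * s) (by fun_prop)
  have : wengZetaTwo = fun s ↦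
      (completedRiemannZeta₀ (2 * s) - 1 / (2 * s) - 1 / (1 - 2 * s)) * (1 / (s - 1)) -
      (completedRiemannZeta₀ (2 - 2 * s) - 1 / (2 - 2 * s) - 1 / (1 - (2 - 2 * s))) * (1 / s) := by
    ext s
    rw [wengZetaTwo, completedRiemannZeta_eq, completedRiemannZeta_eq]
  rw [this]
  fun_prop

open Filter Topology in
theorem theorem1p1 :
    Meromorphic wengZetaTwo ∧
      ∀ ρ : ℂ, IsMeromorphicZero wengZetaTwo ρ → ρ.re = 1 / 2 := by
  refine ⟨meromorphic_wengZetaTwo, fun ρ ⟨_, hρ⟩ ↦ re_eq_half_of_xiFun_sub_eq_zero ?_⟩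
  have hξ := differentiable_xiFun.continuous
  have hcont : Continuous fun s : ℂ ↦ xiFun (2 * s) - xiFun (2 * s - 1) := by fun_prop
  have hpoly : Continuous fun s : ℂ ↦ 2 * s * (s - 1) * (2 * s - 1) := by fun_prop
  have hlim := (tendsto_zero_of_meromorphicOrderAt_pos hρ).mul
    (hpoly.continuousAt.tendsto.mono_left (nhdsWithin_le_nhds (a := ρ) (s := {ρ}ᶜ)))
  rw [zero_mul] at hlim
  refine tendsto_nhds_unique
    (hcont.continuousAt.tendsto.mono_left (nhdsWithin_le_nhds (a := ρ) (s := {ρ}ᶜ)))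
    (hlim.congr' ?_)
  have hne : ∀ a : ℂ, ∀ᶠ s in 𝓝[≠] ρ, s ≠ a := fun a ↦ by
    rcases eq_or_ne ρ a with rfl | h
    · exact self_mem_nhdsWithin
    · exact nhdsWithin_le_nhds (isOpen_ne.mem_nhds h)
  filter_upwards [hne 0, hne 1, hne (1 / 2)] with s h0 h1 h2
  exact wengZetaTwo_mul_eq_xiFun_sub h0 h1 fun h ↦ h2 (by linear_combination h / 2)
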